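/- **Setting.** Let $Z_1,Z_2,\dots$ be i.i.d. with law $P_0$ in a model $\mathcal M$ of probability measures that is nonparametric at $P_0$ (scores of paths in $\mathcal M$ through $P_0$ that are differentiable in quadratic mean span a dense subspace of the mean-zero functions in $L_2(P_0)$). For $P\in\mathcal M$ let $\Theta^*\subset\Theta$ be classes of functions $\mathcal O\to\mathcal K\subseteq\mathbb R$ (they may depend on $P$), let $G_P$ be a real-valued goodness-of-fit functional with minimizers $\theta_P$ over $\Theta$ and $\theta_P^*$ over $\Theta^*$, and let $\Psi_P=G_P(\theta_P^*)-G_P(\theta_P)$, $\Psi_0=\Psi_{P_0}$. Let $g:\mathcal K\times\mathbb R\to\mathcal K$ satisfy $g(k,0)=k$, let $\mathcal F$ be a class of functions $\mathcal O\to\mathbb R$ and $\mathcal B\ni 0$ a symmetric interval, put $\theta^*_{P,f}(o;\beta)=g(\theta^*_P(o),\beta f(o))$, and suppose that $\Theta\setminus\Theta^*\subseteq\{\theta^*_{P,f}(\cdot;\beta):f\in\mathcal F,\beta\in\mathcal B\}\subseteq\Theta$. Write $G_{P,f}(\beta)=G_P(\theta^*_{P,f}(\cdot;\beta))$ and $G_{0,f}=G_{P_0,f}$.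 Let $\beta_{0,f}$ minimize $G_{0,f}$ over $\mathcal B$ and let $f_0\in\mathcal F$ satisfy $G_{0,f_0}(\beta_{0,f_0})=\inf_{f\in\mathcal F}G_{0,f}(\beta_{0,f})$. Let $\tilde G_{n,f}(\beta)$ be estimators of $G_{0,f}(\beta)$, let $\tilde\beta_{n,f}\in\mathcal B$ minimize $\tilde G_{n,f}$ over $\mathcal B$, exactly or up to an error that is $o_P(n^{-1/2})$ uniformly in $f$, and let $\tilde\Psi_n=\sup_{f\in\mathcal F}\{\tilde G_{n,f}(0)-\tilde G_{n,f}(\tilde\beta_{n,f})\}$. Convergence in probability is in outer probability where measurability may fail. **Theorem 3.** Suppose that $\Psi_0>0$ and that: - (A1) for all $f\in\mathcal F$, $\beta\in\mathcal B$ the parameter $P\mapsto G_{P,f}(\beta)$ is pathwise differentiable at $P_0$ in $\mathcal M$, with efficient influence function $\phi_{P_0,f}(\cdot;\beta)$; - (A5) the class $\{\phi_{P_0,f}(\cdot;\beta):f\in\mathcal F,\beta\in\mathcal B\}$ is $P_0$-Donsker; - (B1) $\tilde G_{n,f_1}(0)=\tilde G_{n,f_2}(0)$ for all $f_1,f_2\in\mathcal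 F$; - (B2) $\sup_{f\in\mathcal F,\beta\in\mathcal B}\left|\tilde G_{n,f}(\beta)-G_{0,f}(\beta)-\frac1n\sum_{i=1}^n\phi_{P_0,f}(Z_i;\beta)\right|=o_P(n^{-1/2})$; - (margin) there is a sequence of positive numbers $d_n=o(n^{1/2-\delta})$, for some $\delta>0$, with $$\sup_{\{(f,\beta)\in\mathcal F\times\mathcal B:\;G_{0,f}(\beta)-G_{0,f_0}(\beta_{0,f_0})\le d_n\}}\left[\int\{\phi_{P_0,f}(z;\beta)-\phi_{P_0,f_0}(z;\beta_{0,f_0})\}^2\,dP_0(z)\right]^{1/2}=o(1).$$ Then $\tilde\Psi_n$ is an asymptotically linear estimator of $\Psi_0$ with influence function $D(z)=\phi_{P_0,f_0}(z;0)-\phi_{P_0,f_0}(z;\beta_{0,f_0})$, i.e. $D$ has mean zero and finite variance under $P_0$ and $\tilde\Psi_n-\Psi_0=\frac1n\sum_{i=1}^nD(Z_i)+o_P(n^{-1/2})$. Consequently, if $P\mapsto\Psi_P$ is pathwise differentiable at $P_0$ in $\mathcal M$ (as the notion of efficiency presupposes), then $D$ is its efficient influence function, and $\tilde\Psi_n$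 is asymptotically efficient at $P_0$ in the nonparametric model. -/

import Mathlib

open MeasureTheory ProbabilityTheory Filter Topology Asymptotics
open scoped ENNReal BoundedContinuousFunction

noncomputable section

namespace ImprovementInFit

universe u v w

/-! ### Stochastic convergence

A `Measure` applied to a set that need not be measurable is the outer measure of that set, so all
probabilities below are outer probabilities. -/

section Stochastic

variable {Ω : Type u} [MeasurableSpace Ω]

/-- `sup_i R n ω i = o_P(n^{-1/2})` (the supremum over the index set `ι` of the positive part):
the event below says that `√n · sup_i R n ω i` exceeds `ε`. -/
def SupLittleOPRootN (μ : Measure Ω) {ι : Type v} (R : ℕ → Ω → ι → ℝ) : Prop :=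
  ∀ ε : ℝ, 0 < ε →
    Tendsto (fun n : ℕ => μ {ω | ∃ i, ε < √(n : ℝ) * R n ω i}) atTop (𝓝 0)

/-- Outer expectation of a bounded, possibly non-measurable, function: the infimum of the
expectations of its integrable majorants. -/
def outerExpectation (μ : Measure Ω) (h : Ω → ℝ) : ℝ :=
  sInf {c : ℝ | ∃ v : Ω → ℝ, Measurable v ∧ Integrable v μ ∧ (∀ ω, h ω ≤ v ω) ∧ c = ∫ ω, v ω ∂μ}

/-- Weak convergence (in the sense of Hoffmann-Jørgensen) of a sequence of possibly non-measurable
random elements of `E` to the Borel law `ν`: outer expectations of bounded continuous functions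
converge. -/
def WeaklyConverges (μ : Measure Ω) {E : Type v} [TopologicalSpace E] [MeasurableSpace E]
    [BorelSpace E] (X : ℕ → Ω → E) (ν : Measure E) : Prop :=
  ∀ h : E →ᵇ ℝ,
    Tendsto (fun n => outerExpectation μ (fun ω => h (X n ω))) atTop (𝓝 (∫ x, h x ∂ν))

end Stochastic

/-! ### Empirical processes and Donsker classes -/

/-- The space `ℓ^∞(T)` of bounded real functions on `T` with the supremum norm. -/
abbrev EllInfty (T : Type u) : Type u := lp (fun _ : T => ℝ) ∞

instance instMeasurableSpaceEllInfty (T : Type u) : MeasurableSpace (EllInfty T) := borel _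

instance instBorelSpaceEllInfty (T : Type u) : BorelSpace (EllInfty T) := ⟨rfl⟩

open Classical in
/-- A bounded function on `T` seen as a point of `ℓ^∞(T)` (and `0` if it is not bounded). -/
def toEllInfty {T : Type u} (x : T → ℝ) : EllInfty T :=
  if h : Memℓp x ∞ then ⟨x, h⟩ else 0

section Empirical

variable {𝒵 : Type u} [MeasurableSpace 𝒵]

/-- The empirical mean `(1/n) ∑_{i=1}^n h(z_i)`; the sample is indexed from `0`. -/
def empMean (h : 𝒵 → ℝ) (z : ℕ → 𝒵) (n : ℕ) : ℝ :=
  (n : ℝ)⁻¹ * ∑ i ∈ Finset.range n, h (z i)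

/-- The empirical process `t ↦ √n (ℙ_n - P) φ_t`. -/
def empProcess (P : Measure 𝒵) {T : Type v} (φ : T → 𝒵 → ℝ) (n : ℕ) (z : ℕ → 𝒵) (t : T) : ℝ :=
  √(n : ℝ) * (empMean (φ t) z n - ∫ y, φ t y ∂P)

/-- The class `{φ_t : t ∈ T}` is `P`-Donsker: it consists of measurable, square-integrable
functions, the centred functions are pointwise bounded over the class (so that the empirical
process takes values in `ℓ^∞(T)`), and the empirical process of i.i.d. draws from `P` (the
coordinates on the infinite product space) converges weakly in `ℓ^∞(T)` to a tight Borel law.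
(By the multivariate central limit theorem that law can only be the one of the `P`-Brownian
bridge.) -/
def IsDonsker (P : Measure 𝒵) [IsProbabilityMeasure P] {T : Type v} (φ : T → 𝒵 → ℝ) : Prop :=
  (∀ t, Measurable (φ t)) ∧
  (∀ t, MemLp (φ t) 2 P) ∧
  (∀ z, BddAbove (Set.range fun t => |φ t z - ∫ y, φ t y ∂P|)) ∧
  ∃ ν : Measure (EllInfty T), IsProbabilityMeasure ν ∧ IsTightMeasureSet {ν} ∧
    WeaklyConverges (Measure.infinitePi fun _ : ℕ => P)
      (fun n z => toEllInfty (empProcess P φ n z)) ν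

/-! ### Pathwise differentiability and efficiency -/

/-- `p` is a one-dimensional submodel of the model `M` through `P₀` at `t = 0` which is
differentiable in quadratic mean with score `s`: with `μ_t = P_t + P₀` as dominating measure,
`∫ [ (√p_t - √p₀) / t - (1/2) s √p₀ ]² dμ_t → 0` as `t → 0`. -/
def IsRegularPath (M : Set (Measure 𝒵)) (P₀ : Measure 𝒵) (p : ℝ → Measure 𝒵) (s : 𝒵 → ℝ) : Prop :=
  p 0 = P₀ ∧ (∀ᶠ t in 𝓝 (0 : ℝ), p t ∈ M) ∧ MemLp s 2 P₀ ∧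
  Tendsto (fun t : ℝ => ∫⁻ z, ENNReal.ofReal
      (((√((p t).rnDeriv (p t + P₀) z).toReal - √(P₀.rnDeriv (p t + P₀) z).toReal) / t
        - 2⁻¹ * s z * √(P₀.rnDeriv (p t + P₀) z).toReal) ^ 2) ∂(p t + P₀))
    (𝓝[≠] 0) (𝓝 0)

/-- The model `M` is (locally) nonparametric at `P₀`: the linear span of the scores of the regular
paths in `M` is dense in the space of mean-zero functions in `L²(P₀)`. -/
def IsNonparametricAt (M : Set (Measure 𝒵)) (P₀ : Measure 𝒵) : Prop :=
  ∀ h : 𝒵 → ℝ, MemLp h 2 P₀ → ∫ z, h z ∂P₀ = 0 → ∀ ε : ℝ≥0∞, 0 < ε →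
    ∃ s ∈ Submodule.span ℝ {s : 𝒵 → ℝ | ∃ p, IsRegularPath M P₀ p s}, eLpNorm (h - s) 2 P₀ < ε

/-- `D` is the efficient influence function at `P₀` of the parameter `τ`, in a model `M` that is
nonparametric at `P₀`: `D` is a mean-zero element of `L²(P₀)` representing the derivative of `τ`
along every regular path in `M`. (In a nonparametric model such a `D` is unique up to `P₀`-null
sets, because scores span a dense subspace.) -/
def IsEfficientInfluenceFunction (M : Set (Measure 𝒵)) (τ : Measure 𝒵 → ℝ) (P₀ : Measure 𝒵)
    (D : 𝒵 → ℝ) : Prop :=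
  MemLp D 2 P₀ ∧ ∫ z, D z ∂P₀ = 0 ∧
  ∀ (p : ℝ → Measure 𝒵) (s : 𝒵 → ℝ), IsRegularPath M P₀ p s →
    HasDerivAt (fun t => τ (p t)) (∫ z, D z * s z ∂P₀) 0

/-- `τ` is pathwise differentiable at `P₀` in the nonparametric model `M`. -/
def IsPathwiseDifferentiable (M : Set (Measure 𝒵)) (τ : Measure 𝒵 → ℝ) (P₀ : Measure 𝒵) : Prop :=
  ∃ D : 𝒵 → ℝ, IsEfficientInfluenceFunction M τ P₀ D

variable {Ω : Type v} [MeasurableSpace Ω]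

/-- The estimator `est n` of the number `ψ₀`, computed from the observations `Z 0, …, Z (n-1)` with
law `P₀`, is asymptotically linear with influence function `D`: `D` has mean zero and finite
variance, and `est n - ψ₀ = (1/n) ∑ D(Z_i) + o_P(n^{-1/2})`. -/
def IsAsymptoticallyLinear (μ : Measure Ω) (Z : ℕ → Ω → 𝒵) (P₀ : Measure 𝒵) (est : ℕ → Ω → ℝ)
    (ψ₀ : ℝ) (D : 𝒵 → ℝ) : Prop :=
  MemLp D 2 P₀ ∧ ∫ z, D z ∂P₀ = 0 ∧
  TendstoInMeasure μ
    (fun (n : ℕ) ω => √(n : ℝ) * (est n ω - ψ₀ - empMean D (fun i => Z i ω) n)) atTop (fun _ => 0)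

/-- The estimator `est` of `τ(P₀)` is asymptotically efficient at `P₀` in the nonparametric model
`M`: it is asymptotically linear, and its influence function is the efficient one. -/
def IsAsymptoticallyEfficient (μ : Measure Ω) (Z : ℕ → Ω → 𝒵) (M : Set (Measure 𝒵))
    (τ : Measure 𝒵 → ℝ) (P₀ : Measure 𝒵) (est : ℕ → Ω → ℝ) : Prop :=
  ∃ D : 𝒵 → ℝ, IsEfficientInfluenceFunction M τ P₀ D ∧
    IsAsymptoticallyLinear μ Z P₀ est (τ P₀) D

end Empirical

/-! ### The improvement in fit -/

/-- The goodness-of-fit framework for function-valued parameters `𝒪 → 𝒦`, `𝒦 ⊆ ℝ`.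
The classes `Θ` and `Θ*` may vary with `P`, as the parametrization of `Θ \ Θ*` by submodels
through `θ*_P` does; classes that are fixed are the case of constant functions of `P`. -/
structure Framework (𝒵 : Type u) [MeasurableSpace 𝒵] (𝒪 : Type v) (𝒦 : Set ℝ) where
  /-- the statistical model -/
  model : Set (Measure 𝒵)
  isProbabilityMeasure_of_mem : ∀ P ∈ model, IsProbabilityMeasure P
  /-- the full class `Θ` -/
  full : Measure 𝒵 → Set (𝒪 → 𝒦)
  /-- the reduced class `Θ*` -/
  reduced : Measure 𝒵 → Set (𝒪 → 𝒦)
  reduced_subset_full : ∀ P ∈ model, reduced P ⊆ full P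
  /-- the goodness-of-fit functional `G_P` -/
  G : Measure 𝒵 → (𝒪 → 𝒦) → ℝ
  /-- the best fit `θ_P` in the full class -/
  best : Measure 𝒵 → 𝒪 → 𝒦
  best_mem : ∀ P ∈ model, best P ∈ full P
  best_isMinOn : ∀ P ∈ model, IsMinOn (G P) (full P) (best P)
  /-- the best fit `θ*_P` in the reduced class -/
  bestReduced : Measure 𝒵 → 𝒪 → 𝒦
  bestReduced_mem : ∀ P ∈ model, bestReduced P ∈ reduced P
  bestReduced_isMinOn : ∀ P ∈ model, IsMinOn (G P) (reduced P) (bestReduced P)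
  /-- the function that generates the one-dimensional submodels -/
  g : 𝒦 → ℝ → 𝒦
  g_zero : ∀ k, g k 0 = k
  /-- the class `ℱ` of directions -/
  F : Set (𝒪 → ℝ)
  /-- the symmetric interval `ℬ` -/
  B : Set ℝ
  B_ordConnected : B.OrdConnected
  B_symm : ∀ β ∈ B, -β ∈ B
  zero_mem_B : (0 : ℝ) ∈ B
  /-- the submodels lie in the full class -/
  submodel_mem : ∀ P ∈ model, ∀ f ∈ F, ∀ β ∈ B,
    (fun o => g (bestReduced P o) (β * f o)) ∈ full P
  /-- the submodels exhaust the difference of the full and the reduced class -/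
  exhaust : ∀ P ∈ model, ∀ θ ∈ full P \ reduced P,
    ∃ f ∈ F, ∃ β ∈ B, θ = fun o => g (bestReduced P o) (β * f o)

namespace Framework

variable {𝒵 : Type u} [MeasurableSpace 𝒵] {𝒪 : Type v} {𝒦 : Set ℝ} (S : Framework 𝒵 𝒪 𝒦)

/-- The submodel `θ*_{P,f}(·; β) : o ↦ g(θ*_P(o), β f(o))`. -/
def submodel (P : Measure 𝒵) (f : S.F) (β : S.B) : 𝒪 → 𝒦 :=
  fun o => S.g (S.bestReduced P o) ((β : ℝ) * (f : 𝒪 → ℝ) o)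

/-- The goodness of fit along the submodel, `G_{P,f}(β) = G_P(θ*_{P,f}(·; β))`. -/
def fit (P : Measure 𝒵) (f : S.F) (β : S.B) : ℝ := S.G P (S.submodel P f β)

/-- The improvement in fit `Ψ_P = G_P(θ*_P) - G_P(θ_P)`. -/
def improvement (P : Measure 𝒵) : ℝ := S.G P (S.bestReduced P) - S.G P (S.best P)

/-- The point `β = 0` of the interval `ℬ`. -/
def zeroB : S.B := ⟨0, S.zero_mem_B⟩

/-- The estimator `Ψ̃_n = sup_{f ∈ ℱ} {G̃_{n,f}(0) - G̃_{n,f}(β̃_{n,f})}`. -/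
def improvementEstimator {Ω : Type w} (Gn : ℕ → Ω → S.F → S.B → ℝ) (βn : ℕ → Ω → S.F → S.B)
    (n : ℕ) (ω : Ω) : ℝ :=
  ⨆ f : S.F, (Gn n ω f S.zeroB - Gn n ω f (βn n ω f))

end Framework

end ImprovementInFit

end

noncomputable section

namespace ImprovementInFit

open Metric Set

universe u v w


/-! By (B1) and near-minimization, the estimator is, up to `o_P(n^{-1/2})`, the common value of the
estimated fits at `β = 0` minus their infimum over `ℱ × ℬ`. By (B2), `√n` times the estimated fit is
`√n` times the true fit plus the empirical process, uniformly up to `o_P(1)`, so it suffices to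
expand the infimum of that sum (`IsDonsker.eventually_infimum`). Where the true fit exceeds its
minimum by more than a fixed `η`, the drift `√n η` beats the empirical process, which is bounded in
probability. Where it does not, the margin condition puts the influence function close in `L²(P₀)`
to the one at the minimizer, and equicontinuity makes the two empirical processes agree up to `ε`.
Hence the infimum expands like the value at the minimizer `(f₀, β₀ f₀)`.

Equicontinuity comes from tightness of the limit alone, without Gaussianity: compact subsets of
`ℓ^∞(T)` are nearly constant on the cells of a finite partition, and Chebyshev's inequality controls
one representative per cell.

For efficiency, `Ψ_P` dominates the improvement along the fixed submodel point `(f₀, β₀ f₀)` for all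
`P` in the model, with equality at `P₀`; two differentiable functions that touch in this way have
the same derivative. -/

/-! ### Asymptotic tightness and compactness in `ℓ^∞(T)`. -/

/-- The outer expectation of a bounded nonnegative function dominates the outer probability of the
set where the function is at least one. -/
lemma measureReal_le_outerExpectation {Ω : Type*} [MeasurableSpace Ω] {μ : Measure Ω}
    [IsProbabilityMeasure μ] {h : Ω → ℝ} {C : ℝ} (h_nonneg : ∀ ω, 0 ≤ h ω) (h_le : ∀ ω, h ω ≤ C) :
    μ.real {ω | 1 ≤ h ω} ≤ outerExpectation μ h := by
  refine le_csInf ⟨C, fun _ => C, measurable_const, integrable_const _, h_le, by simp⟩ ?_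
  rintro c ⟨v, -, hv_int, hv, rfl⟩
  calc μ.real {ω | 1 ≤ h ω} ≤ μ.real {ω | 1 ≤ v ω} :=
        measureReal_mono fun ω hω => le_trans hω (hv ω)
    _ ≤ ∫ ω, v ω ∂μ := by
        simpa using mul_meas_ge_le_integral_of_nonneg
          (ae_of_all _ fun ω => (h_nonneg ω).trans (hv ω)) hv_int 1

/-- A sequence that converges weakly to a tight law is asymptotically tight: up to small outer
probability it ends up in every neighbourhood of some compact set. -/
lemma WeaklyConverges.exists_isCompact {Ω : Type*} [MeasurableSpace Ω] {μ : Measure Ω}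
    [IsProbabilityMeasure μ] {E : Type*} [NormedAddCommGroup E] [MeasurableSpace E]
    [BorelSpace E] {X : ℕ → Ω → E} {ν : Measure E} [IsProbabilityMeasure ν]
    (hX : WeaklyConverges μ X ν) (hν : IsTightMeasureSet {ν}) {κ : ℝ} (hκ : 0 < κ) :
    ∃ K : Set E, IsCompact K ∧ ∀ ε : ℝ, 0 < ε →
      ∀ᶠ n in atTop, μ.real {ω | ∀ y ∈ K, ε ≤ dist (X n ω) y} < κ := by
  obtain ⟨K₀, hK₀, hK₀ν⟩ := isTightMeasureSet_iff_exists_isCompact_measure_compl_le.1 hν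
    (ENNReal.ofReal (κ / 2)) (by simpa using hκ)
  -- Adding `0` makes the compact set nonempty, so that `infDist` to it is a genuine infimum.
  set K : Set E := insert 0 K₀
  have hK : IsCompact K := hK₀.insert 0
  have hK_ne : K.Nonempty := ⟨0, mem_insert _ _⟩
  have hKν : ν.real Kᶜ ≤ κ / 2 := by
    have h1 : ν Kᶜ ≤ ENNReal.ofReal (κ / 2) :=
      (measure_mono (compl_subset_compl.2 (subset_insert _ _))).trans (hK₀ν ν rfl)
    exact ENNReal.toReal_le_of_le_ofReal (by positivity) h1
  refine ⟨K, hK, fun ε hε => ?_⟩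
  -- A continuous test function that is `0` on `K` and `1` at distance at least `ε`: its limiting
  -- mean is at most `ν(Kᶜ) ≤ κ / 2`.
  let h : E →ᵇ ℝ := BoundedContinuousFunction.ofNormedAddCommGroup
    (fun x => min 1 (infDist x K / ε))
    (continuous_const.min ((continuous_infDist_pt K).div_const ε)) 1 (fun x => by
      have : 0 ≤ min 1 (infDist x K / ε) := le_min zero_le_one (div_nonneg infDist_nonneg hε.le)
      rw [Real.norm_of_nonneg this]
      exact min_le_left _ _)
  have h_apply (x : E) : h x = min 1 (infDist x K / ε) := rfl
  have h_nonneg (x : E) : 0 ≤ h x := le_min zero_le_one (div_nonneg infDist_nonneg hε.le)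
  have h_le (x : E) : h x ≤ 1 := min_le_left _ _
  have h_int : ∫ x, h x ∂ν < κ := by
    calc ∫ x, h x ∂ν ≤ ∫ x, Kᶜ.indicator (fun _ => (1 : ℝ)) x ∂ν := by
          refine integral_mono (h.integrable ν)
            ((integrable_const _).indicator hK.isClosed.measurableSet.compl) fun x => ?_
          by_cases hx : x ∈ K
          · simp [h_apply, hx, infDist_zero_of_mem hx]
          · simpa [hx] using h_le x
      _ = ν.real Kᶜ := integral_indicator_one hK.isClosed.measurableSet.compl
      _ < κ := by linarith
  filter_upwards [(hX h).eventually_lt_const h_int] with n hn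
  refine lt_of_le_of_lt ((measureReal_mono fun ω hω => ?_).trans
    (measureReal_le_outerExpectation (fun ω => h_nonneg _) (fun ω => h_le _))) hn
  simp only [mem_ofPred_eq, h_apply] at hω ⊢
  exact le_min le_rfl ((one_le_div hε).2 ((le_infDist hK_ne).2 fun {y} hy => hω y hy))

/-- The functions in a compact subset of `ℓ^∞(T)` are uniformly bounded, and up to `ε` they are
constant on the cells of a finite partition of `T`. -/
lemma exists_finite_partition_of_isCompact {T : Type v} {K : Set (EllInfty T)} (hK : IsCompact K)
    {ε : ℝ} (hε : 0 < ε) :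
    ∃ (ι : Type v) (_ : Finite ι) (c : T → ι) (C : ℝ), ∀ x ∈ K,
      (∀ t, |x t| ≤ C) ∧ ∀ s t, c s = c t → |x s - x t| ≤ ε := by
  obtain ⟨C, hC⟩ := hK.isBounded.exists_norm_le
  have norm_apply_le (x : EllInfty T) (t : T) : |x t| ≤ ‖x‖ :=
    lp.norm_apply_le_norm (by simp) x t
  obtain ⟨Y, hYK, hY_fin, hY⟩ := totallyBounded_iff_subset.1 hK.totallyBounded _
    (dist_mem_uniformity (show 0 < ε / 4 by positivity))
  have : Fintype Y := hY_fin.fintype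
  -- Each index is sent to its values on a finite `ε / 4`-net of `K`. The image is bounded in a
  -- finite-dimensional space, so finitely many `ε / 8`-balls cover it; these are the cells.
  let e : T → Y → ℝ := fun t y => y.1 t
  have he_bdd : Bornology.IsBounded (range e) := by
    refine isBounded_iff_forall_norm_le.2 ⟨max C 0, ?_⟩
    rintro _ ⟨t, rfl⟩
    exact (pi_norm_le_iff_of_nonneg (le_max_right _ _)).2 fun y =>
      (norm_apply_le y.1 t).trans ((hC _ (hYK y.2)).trans (le_max_left _ _))
  obtain ⟨V, hV_fin, hV⟩ := totallyBounded_iff.1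
    (he_bdd.isCompact_closure.totallyBounded.subset subset_closure) (ε / 8) (by positivity)
  have hcell (t : T) : ∃ a : V, dist (e t) a.1 < ε / 8 := by
    simpa using hV (mem_range_self t)
  choose c hc using hcell
  refine ⟨V, hV_fin, c, C, fun x hx => ⟨fun t => (norm_apply_le x t).trans (hC x hx), ?_⟩⟩
  intro s t hst
  obtain ⟨y, hy, hxy⟩ : ∃ y ∈ Y, dist x y < ε / 4 := by simpa using hY hx
  have h1 (r : T) : |x r - y r| < ε / 4 := by
    refine lt_of_le_of_lt ?_ (dist_eq_norm x y ▸ hxy)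
    simpa using norm_apply_le (x - y) r
  have h2 : |y s - y t| < ε / 4 := by
    have h3 : dist (e s) (e t) < ε / 4 := by
      have h4 := hc s
      rw [hst] at h4
      linarith [dist_triangle_right (e s) (e t) (c t), hc t]
    exact (dist_le_pi_dist (e s) (e t) ⟨y, hy⟩).trans_lt h3
  have h3 := h1 s
  have h4 := h1 t
  rw [abs_lt] at h2 h3 h4
  rw [abs_le]
  constructor <;> linarith

/-! ### The empirical process over a Donsker class. -/

section Donsker

variable {𝒵 : Type u} [MeasurableSpace 𝒵]

lemma empProcess_eq {P : Measure 𝒵} [IsProbabilityMeasure P] {T : Type v} (φ : T → 𝒵 → ℝ) {n : ℕ}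
    (hn : n ≠ 0) (z : ℕ → 𝒵) (t : T) :
    empProcess P φ n z t = √(n : ℝ) * ((n : ℝ)⁻¹ *
      ∑ i ∈ Finset.range n, (φ t (z i) - ∫ y, φ t y ∂P)) := by
  have : (n : ℝ) ≠ 0 := by exact_mod_cast hn
  simp only [empProcess, empMean, Finset.sum_sub_distrib, Finset.sum_const, Finset.card_range,
    nsmul_eq_mul]
  rw [mul_sub (n : ℝ)⁻¹, inv_mul_cancel_left₀ this]

/-- Ensures that `toEllInfty` never takes its default value `0` on the empirical process: pointwise
bounds on the centred class add up over a finite sample. -/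
lemma memℓp_empProcess {P : Measure 𝒵} [IsProbabilityMeasure P] {T : Type v} {φ : T → 𝒵 → ℝ}
    (hφ : ∀ z, BddAbove (range fun t => |φ t z - ∫ y, φ t y ∂P|)) (n : ℕ) (z : ℕ → 𝒵) :
    Memℓp (empProcess P φ n z) ∞ := by
  choose C hC using hφ
  rcases eq_or_ne n 0 with rfl | hn
  · have : empProcess P φ 0 z = 0 := by ext t; simp [empProcess]
    rw [this]
    exact zero_memℓp
  refine memℓp_infty ⟨√(n : ℝ) * ((n : ℝ)⁻¹ * ∑ i ∈ Finset.range n, C (z i)), ?_⟩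
  rintro _ ⟨t, rfl⟩
  simp only [empProcess_eq φ hn, norm_mul, Real.norm_eq_abs, abs_inv, Nat.abs_cast,
    abs_of_nonneg (Real.sqrt_nonneg (n : ℝ))]
  gcongr
  exact (Finset.abs_sum_le_sum_abs _ _).trans
    (Finset.sum_le_sum fun i _ => hC (z i) (mem_range_self t))

lemma toEllInfty_apply {T : Type v} {x : T → ℝ} (hx : Memℓp x ∞) (t : T) :
    toEllInfty x t = x t := by
  simp [toEllInfty, hx]

/-- The empirical process over a Donsker class is asymptotically bounded in outer probability, and
asymptotically constant up to `ε` on the cells of a finite partition of the index set. -/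
lemma IsDonsker.exists_finite_partition {P : Measure 𝒵} [IsProbabilityMeasure P] {T : Type v}
    {φ : T → 𝒵 → ℝ} (hφ : IsDonsker P φ) {ε κ : ℝ} (hε : 0 < ε) (hκ : 0 < κ) :
    ∃ (ι : Type v) (_ : Finite ι) (c : T → ι) (C : ℝ), ∀ᶠ n in atTop,
      (Measure.infinitePi fun _ : ℕ => P).real {z | ¬ ((∀ t, |(empProcess P φ n z t)| ≤ C) ∧
        ∀ s t, c s = c t → |(empProcess P φ n z s) - empProcess P φ n z t| ≤ ε)} < κ := by
  obtain ⟨-, -, hbdd, ν, hν_prob, hν_tight, hν⟩ := hφ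
  obtain ⟨K, hK, hXK⟩ := hν.exists_isCompact hν_tight hκ
  obtain ⟨ι, hι, c, C, hc⟩ := exists_finite_partition_of_isCompact hK
    (show 0 < ε / 2 by positivity)
  -- Near `K` the process is within `ε / 4` of some `y ∈ K`: this adds `ε / 4` to the bound, and `2
  -- · ε / 4` to the oscillation `ε / 2` of `y` on a cell.
  refine ⟨ι, hι, c, C + ε / 4, ?_⟩
  filter_upwards [hXK (ε / 4) (by positivity)] with n hn
  refine (measureReal_mono fun z hz => ?_).trans_lt hn
  by_contra hz'
  obtain ⟨y, hyK, hy⟩ : ∃ y ∈ K, dist (toEllInfty (empProcess P φ n z)) y < ε / 4 := by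
    simpa using hz'
  have hmem := memℓp_empProcess hbdd n z
  have h1 (t : T) : |(empProcess P φ n z t) - y t| < ε / 4 := by
    rw [dist_eq_norm] at hy
    refine lt_of_le_of_lt ?_ hy
    have := lp.norm_apply_le_norm (by simp) (toEllInfty (empProcess P φ n z) - y) t
    simpa [toEllInfty_apply hmem] using this
  refine hz ⟨fun t => ?_, fun s t hst => ?_⟩
  · have h2 := abs_le.1 ((hc y hyK).1 t)
    have h3 := abs_lt.1 (h1 t)
    rw [abs_le]
    constructor <;> linarith
  · have h2 := abs_le.1 ((hc y hyK).2 s t hst)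
    have h3 := abs_lt.1 (h1 t)
    have h4 := abs_lt.1 (h1 s)
    rw [abs_le]
    constructor <;> linarith

/-- Chebyshev's inequality for an increment of the empirical process. -/
lemma measureReal_le_abs_empProcess_sub_le {P : Measure 𝒵} [IsProbabilityMeasure P] {T : Type v}
    {φ : T → 𝒵 → ℝ} {s t : T} (hs : Measurable (φ s)) (ht : Measurable (φ t))
    (hs2 : MemLp (φ s) 2 P) (ht2 : MemLp (φ t) 2 P) (n : ℕ) {ε : ℝ} (hε : 0 < ε) :
    (Measure.infinitePi fun _ : ℕ => P).real
      {z | ε ≤ |(empProcess P φ n z s) - empProcess P φ n z t|} ≤ Var[φ s - φ t; P] / ε ^ 2 := by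
  set Q := Measure.infinitePi fun _ : ℕ => P
  set W : 𝒵 → ℝ := φ s - φ t
  have hWm : Measurable W := hs.sub ht
  have hW2 : MemLp W 2 P := hs2.sub ht2
  rcases eq_or_ne n 0 with rfl | hn
  · have : {z : ℕ → 𝒵 | ε ≤ |(empProcess P φ 0 z s) - empProcess P φ 0 z t|} = ∅ := by
      ext z; simpa [empProcess] using hε
    rw [this, measureReal_empty]
    exact div_nonneg (variance_nonneg _ _) (by positivity)
  have hn' : (n : ℝ) ≠ 0 := by exact_mod_cast hn
  have hmp (i : ℕ) : MeasurePreserving (fun z : ℕ → 𝒵 => z i) Q P :=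
    measurePreserving_eval_infinitePi _ i
  have hWi (i : ℕ) : MemLp (fun z : ℕ → 𝒵 => W (z i)) 2 Q := hW2.comp_measurePreserving (hmp i)
  let S : (ℕ → 𝒵) → ℝ := ∑ i ∈ Finset.range n, fun z : ℕ → 𝒵 => W (z i)
  have hS : MemLp S 2 Q := memLp_finsetSum' _ fun i _ => hWi i
  -- The normalization cancels the factor `n` in the variance of an independent sum, so the bound is
  -- uniform in `n`.
  have hvar : Var[fun z => (√(n : ℝ) * (n : ℝ)⁻¹) * S z; Q] = Var[W; P] := by
    have h1 : Var[S; Q] = ∑ i ∈ Finset.range n, Var[fun z : ℕ → 𝒵 => W (z i); Q] := by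
      refine IndepFun.variance_sum (fun i _ => hWi i) fun i _ j _ hij => ?_
      exact (iIndepFun_infinitePi (P := fun _ : ℕ => P) (X := fun _ => W)
        (fun _ => hWm)).indepFun hij
    have h2 (i : ℕ) : Var[fun z : ℕ → 𝒵 => W (z i); Q] = Var[W; P] := by
      have := variance_map (X := W) (μ := Q) (Y := fun z : ℕ → 𝒵 => z i)
        (by rw [(hmp i).map_eq]; exact hWm.aemeasurable) (hmp i).measurable.aemeasurable
      rw [(hmp i).map_eq] at this
      exact this.symm
    rw [variance_const_mul, h1]
    simp only [h2, Finset.sum_const, Finset.card_range, nsmul_eq_mul, mul_pow,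
      Real.sq_sqrt (Nat.cast_nonneg n)]
    field_simp
  have hmean : Q[fun z => (√(n : ℝ) * (n : ℝ)⁻¹) * S z] = √(n : ℝ) * ∫ y, W y ∂P := by
    have h1 : ∫ z, S z ∂Q = n * ∫ y, W y ∂P := by
      simp only [S, Finset.sum_apply]
      rw [integral_finsetSum _ fun i _ => (hWi i).integrable one_le_two]
      have h2 (i : ℕ) : ∫ z : ℕ → 𝒵, W (z i) ∂Q = ∫ y, W y ∂P := by
        rw [← (hmp i).map_eq, integral_map (hmp i).measurable.aemeasurable
          hWm.aestronglyMeasurable]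
      simp [h2]
    rw [integral_const_mul, h1, mul_assoc, inv_mul_cancel_left₀ hn']
  have key := meas_ge_le_variance_div_sq (μ := Q) (hS.const_mul (√(n : ℝ) * (n : ℝ)⁻¹)) hε
  rw [hvar, hmean] at key
  refine ENNReal.toReal_le_of_le_ofReal (div_nonneg (variance_nonneg _ _) (by positivity))
    (le_trans (le_of_eq ?_) key)
  congr 1
  ext z
  have hint : ∫ y, W y ∂P = ∫ y, φ s y ∂P - ∫ y, φ t y ∂P :=
    integral_sub (hs2.integrable one_le_two) (ht2.integrable one_le_two)
  simp only [mem_ofPred_eq, empProcess, empMean, hint, S, Finset.sum_apply]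
  simp only [W, Pi.sub_apply, Finset.sum_sub_distrib]
  ring_nf

/-- A Donsker class is asymptotically equicontinuous at each of its members. -/
lemma IsDonsker.exists_equicontinuous {P : Measure 𝒵} [IsProbabilityMeasure P] {T : Type v}
    {φ : T → 𝒵 → ℝ} (hφ : IsDonsker P φ) (t₀ : T) {ε κ : ℝ} (hε : 0 < ε) (hκ : 0 < κ) :
    ∃ δ : ℝ, 0 < δ ∧ ∀ᶠ n in atTop, (Measure.infinitePi fun _ : ℕ => P).real
      {z | ∃ t, Var[φ t - φ t₀; P] ≤ δ ∧
        ε < |(empProcess P φ n z t) - empProcess P φ n z t₀|} < κ := by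
  classical
  obtain ⟨ι, hι, c, C, hc⟩ := hφ.exists_finite_partition (show 0 < ε / 2 by positivity)
    (show 0 < κ / 2 by positivity)
  have := Fintype.ofFinite ι
  obtain ⟨hm, h2, -, -⟩ := hφ
  set N : ℝ := (Fintype.card ι : ℝ) with hN
  have hN0 : 0 ≤ N := Nat.cast_nonneg _
  -- Chosen so that the Chebyshev bounds `δ / (ε / 2) ^ 2` of at most `N` representatives sum to at
  -- most `κ / 2`; the `+ 1` keeps the denominator positive.
  set δ : ℝ := κ / 2 * (ε / 2) ^ 2 / (N + 1) with hδ_def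
  have hδ : 0 < δ := by positivity
  refine ⟨δ, hδ, ?_⟩
  have hrep (j : ι) : ∃ r : T, (∃ t, Var[φ t - φ t₀; P] ≤ δ ∧ c t = j) →
      Var[φ r - φ t₀; P] ≤ δ ∧ c r = j := by
    by_cases h : ∃ t, Var[φ t - φ t₀; P] ≤ δ ∧ c t = j
    · obtain ⟨r, hr⟩ := h
      exact ⟨r, fun _ => hr⟩
    · exact ⟨t₀, fun h' => absurd h' h⟩
  choose r hr using hrep
  filter_upwards [hc] with n hn
  set Q := Measure.infinitePi fun _ : ℕ => P
  set J : Finset ι := Finset.univ.filter fun j => Var[φ (r j) - φ t₀; P] ≤ δ with hJ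
  set A : ι → Set (ℕ → 𝒵) := fun j =>
    {z | ε / 2 ≤ |(empProcess P φ n z (r j)) - empProcess P φ n z t₀|} with hA
  set D : Set (ℕ → 𝒵) := {z | ¬ ((∀ t, |(empProcess P φ n z t)| ≤ C) ∧
    ∀ s t, c s = c t → |(empProcess P φ n z s) - empProcess P φ n z t| ≤ ε / 2)} with hD
  have hsub : {z | ∃ t, Var[φ t - φ t₀; P] ≤ δ ∧
      ε < |(empProcess P φ n z t) - empProcess P φ n z t₀|} ⊆ D ∪ ⋃ j ∈ J, A j := by
    rintro z ⟨t, htδ, ht⟩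
    by_cases hz : z ∈ D
    · exact Or.inl hz
    · refine Or.inr ?_
      obtain ⟨h3, h4⟩ := hr (c t) ⟨t, htδ, rfl⟩
      simp only [hD, mem_ofPred_eq, not_not] at hz
      have h5 := hz.2 t (r (c t)) h4.symm
      simp only [mem_iUnion]
      refine ⟨c t, by simp [hJ, h3], ?_⟩
      simp only [hA, mem_ofPred_eq]
      have := abs_sub_le (empProcess P φ n z t) (empProcess P φ n z (r (c t)))
        (empProcess P φ n z t₀)
      linarith
  have hsum : ∑ j ∈ J, Q.real (A j) ≤ κ / 2 := by
    calc ∑ j ∈ J, Q.real (A j) ≤ ∑ j ∈ J, δ / (ε / 2) ^ 2 := by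
          refine Finset.sum_le_sum fun j hj => ?_
          refine (measureReal_le_abs_empProcess_sub_le (hm _) (hm _) (h2 _) (h2 _) n
            (by positivity)).trans ?_
          gcongr
          exact (Finset.mem_filter.1 hj).2
      _ = J.card * (δ / (ε / 2) ^ 2) := by simp
      _ ≤ (N + 1) * (δ / (ε / 2) ^ 2) := by
          gcongr
          have : (J.card : ℝ) ≤ N := Nat.cast_le.2 (Finset.card_le_univ J)
          linarith
      _ = κ / 2 := by rw [hδ_def]; field_simp
  calc _ ≤ Q.real (D ∪ ⋃ j ∈ J, A j) := measureReal_mono hsub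
    _ ≤ Q.real D + Q.real (⋃ j ∈ J, A j) := measureReal_union_le _ _
    _ ≤ Q.real D + ∑ j ∈ J, Q.real (A j) := by
        gcongr
        exact measureReal_biUnion_finset_le _ _
    _ < κ := by linarith

end Donsker

/-! ### Transfer to the sample, and expansion of the infimum. -/

section Estimator

lemma SupLittleOPRootN.eventually_measureReal_lt {Ω : Type u} [MeasurableSpace Ω] {μ : Measure Ω}
    [IsProbabilityMeasure μ] {ι : Type v} {R : ℕ → Ω → ι → ℝ} (hR : SupLittleOPRootN μ R)
    {ε κ : ℝ} (hε : 0 < ε) (hκ : 0 < κ) :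
    ∀ᶠ n : ℕ in atTop, μ.real {ω | ∃ i, ε < √(n : ℝ) * R n ω i} < κ :=
  ((ENNReal.tendsto_toReal_zero_iff fun _ => measure_ne_top _ _).2
    (hR ε hε)).eventually_lt_const hκ

/-- Outer probabilities of events that concern an i.i.d. sample are at most those of the same
events for the coordinates on the infinite product space. -/
lemma measureReal_sample_le {Ω : Type*} [MeasurableSpace Ω] {μ : Measure Ω}
    [IsProbabilityMeasure μ] {𝒵 : Type*} [MeasurableSpace 𝒵] {P : Measure 𝒵}
    [IsProbabilityMeasure P] {Z : ℕ → Ω → 𝒵} (hZ_meas : ∀ i, Measurable (Z i))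
    (hZ_indep : iIndepFun Z μ) (hZ_law : ∀ i, μ.map (Z i) = P) (A : Set (ℕ → 𝒵)) :
    μ.real {ω | (fun i => Z i ω) ∈ A} ≤ (Measure.infinitePi fun _ : ℕ => P).real A := by
  have h1 : μ.map (fun ω i => Z i ω) = Measure.infinitePi fun _ : ℕ => P := by
    rw [(iIndepFun_iff_map_fun_eq_infinitePi_map hZ_meas).1 hZ_indep]
    simp only [hZ_law]
  refine ENNReal.toReal_mono (measure_ne_top _ _) ?_
  rw [← h1]
  -- For nonmeasurable `A` equality may fail, but this direction suffices to carry small outer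
  -- probabilities over to `Ω`.
  exact Measure.le_map_apply (measurable_pi_lambda _ hZ_meas).aemeasurable A

/-- The variance is at most the second moment. -/
lemma variance_le_of_eLpNorm_le {𝒵 : Type*} [MeasurableSpace 𝒵] {P : Measure 𝒵}
    [IsProbabilityMeasure P] {h : 𝒵 → ℝ} (hh : MemLp h 2 P) {r : ℝ} (hr : 0 ≤ r)
    (hle : eLpNorm h 2 P ≤ ENNReal.ofReal r) : Var[h; P] ≤ r ^ 2 := by
  refine (variance_le_expectation_sq hh.aestronglyMeasurable).trans ?_
  have h1 : eLpNorm h 2 P = ENNReal.ofReal ((∫ z, h z ^ 2 ∂P) ^ (2⁻¹ : ℝ)) := by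
    simpa using hh.eLpNorm_eq_integral_rpow_norm two_ne_zero ENNReal.ofNat_ne_top
  rw [h1, ENNReal.ofReal_le_ofReal_iff hr, ← one_div, ← Real.sqrt_eq_rpow] at hle
  exact (Real.sqrt_le_left hr).1 hle

/-- On the event where the estimators `G` of the `fit` have the stochastic expansion `E` and are
nearly minimized by `b`, the supremum of the improvements has the same expansion. -/
lemma abs_sub_iSup_improvement_le {F B : Type*} {G fit E : F → B → ℝ} {b b₀ : F → B}
    {f₀ : F} {o : B} {a ε : ℝ} (ha : 0 < a)
    (hG : ∀ f₁ f₂, G f₁ o = G f₂ o)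
    (hb : ∀ f β, a * (G f (b f) - G f β) ≤ ε)
    (hE : ∀ f β, |a * (G f β - fit f β) - E f β| ≤ ε)
    (hfit : ∀ f β, a * fit f₀ (b₀ f₀) + E f₀ (b₀ f₀) - ε ≤ a * fit f β + E f β) :
    |a * ((⨆ f, (G f o - G f (b f))) - (fit f₀ o - fit f₀ (b₀ f₀)))
      - (E f₀ o - E f₀ (b₀ f₀))| ≤ 3 * ε := by
  have : Nonempty F := ⟨f₀⟩
  set Ψ : ℝ := fit f₀ o - fit f₀ (b₀ f₀)
  set D : ℝ := E f₀ o - E f₀ (b₀ f₀)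
  -- The three errors are the expansions at `(f₀, o)` and `(f, b f)` and the slack in `hfit`. The
  -- bound is uniform in `f`, so the supremum is a genuine one.
  have h_le (f : F) : G f o - G f (b f) ≤ Ψ + (D + 3 * ε) / a := by
    rw [← sub_le_iff_le_add', le_div_iff₀ ha, hG f f₀]
    have h1 := abs_le.1 (hE f₀ o)
    have h2 := abs_le.1 (hE f (b f))
    have h3 := hfit f (b f)
    simp only [Ψ, D]
    linarith
  have h_sup_le : (⨆ f, (G f o - G f (b f))) ≤ Ψ + (D + 3 * ε) / a := ciSup_le h_le
  -- The lower bound needs only the direction `f₀`, where `b f₀` is nearly as good as `b₀ f₀`.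
  have h_le_sup : G f₀ o - G f₀ (b f₀) ≤ ⨆ f, (G f o - G f (b f)) :=
    le_ciSup (f := fun f => G f o - G f (b f)) ⟨_, Set.forall_mem_range.2 h_le⟩ f₀
  rw [← sub_le_iff_le_add', le_div_iff₀ ha] at h_sup_le
  have h1 := abs_le.1 (hE f₀ o)
  have h2 := abs_le.1 (hE f₀ (b₀ f₀))
  have h3 := hb f₀ (b₀ f₀)
  have h4 := mul_le_mul_of_nonneg_left h_le_sup ha.le
  rw [abs_le]
  simp only [Ψ, D] at h_sup_le ⊢
  constructor <;> linarith

/-- The infimum over a Donsker class of the objective function plus its empirical process is, up to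
`o_P(n^{-1/2})`, attained at a minimizer of the objective function which is well separated in the
sense that the functions of nearly minimal objective are close to the one at the minimizer. -/
lemma IsDonsker.eventually_infimum {𝒵 : Type u} [MeasurableSpace 𝒵] {P : Measure 𝒵}
    [IsProbabilityMeasure P] {T : Type v} {φ : T → 𝒵 → ℝ} (hφ : IsDonsker P φ) {fit : T → ℝ}
    {t₀ : T} (ht₀ : ∀ t, fit t₀ ≤ fit t)
    (hsep : ∀ δ > 0, ∃ η > 0, ∀ t, fit t - fit t₀ ≤ η → Var[φ t - φ t₀; P] ≤ δ)
    {ε κ : ℝ} (hε : 0 < ε) (hκ : 0 < κ) :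
    ∀ᶠ n : ℕ in atTop, (Measure.infinitePi fun _ : ℕ => P).real
      {z | ∃ t, √(n : ℝ) * fit t + empProcess P φ n z t <
        √(n : ℝ) * fit t₀ + empProcess P φ n z t₀ - ε} < κ := by
  obtain ⟨δ, hδ, hequi⟩ := hφ.exists_equicontinuous t₀ hε (half_pos hκ)
  obtain ⟨η, hη, hηδ⟩ := hsep δ hδ
  obtain ⟨_, _, _, C, hC⟩ := hφ.exists_finite_partition hε (half_pos hκ)
  have hsqrt : Tendsto (fun n : ℕ => √(n : ℝ) * η) atTop atTop :=
    (Real.tendsto_sqrt_atTop.comp tendsto_natCast_atTop_atTop).atTop_mul_const hη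
  filter_upwards [hequi, hC, hsqrt.eventually_ge_atTop (2 * C)] with n h1 h2 h3
  refine lt_of_le_of_lt ((measureReal_mono ?_ (measure_ne_top _ _)).trans
    (measureReal_union_le _ _)) ((add_lt_add h1 h2).trans_eq (add_halves κ))
  rintro z ⟨t, ht⟩
  -- For a small excess fit, only an increment of the process beyond `ε` can undercut `t₀`. For a
  -- large one the drift `√n η ≥ 2 * C` rules it out while the process stays within `C`.
  by_cases htη : fit t - fit t₀ ≤ η
  · refine Or.inl ⟨t, hηδ t htη, ?_⟩
    have h4 := mul_le_mul_of_nonneg_left (ht₀ t) (Real.sqrt_nonneg n)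
    rw [lt_abs]
    right
    linarith
  · refine Or.inr fun hz => ?_
    have h4 := mul_le_mul_of_nonneg_left (not_le.1 htη).le (Real.sqrt_nonneg n)
    have h5 := abs_le.1 (hz.1 t)
    have h6 := abs_le.1 (hz.1 t₀)
    linarith

end Estimator

/-! ### Improvement in fit and the least favorable submodel. -/

namespace Framework

variable {𝒵 : Type u} [MeasurableSpace 𝒵] {𝒪 : Type v} {𝒦 : Set ℝ} (S : Framework 𝒵 𝒪 𝒦)

lemma submodel_zero (P : Measure 𝒵) (f : S.F) : S.submodel P f S.zeroB = S.bestReduced P := by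
  funext o
  simp [submodel, zeroB, S.g_zero]

/-- The population counterpart of (B1): all submodels start at the same reduced fit. -/
lemma fit_zero (P : Measure 𝒵) (f : S.F) : S.fit P f S.zeroB = S.G P (S.bestReduced P) := by
  rw [fit, submodel_zero]

lemma best_le_fit {P : Measure 𝒵} (hP : P ∈ S.model) (f : S.F) (β : S.B) :
    S.G P (S.best P) ≤ S.fit P f β :=
  S.best_isMinOn P hP (S.submodel_mem P hP f f.2 β β.2)

/-- When the improvement in fit is positive, the best fit lies on a submodel, so that the
improvement is the one along a least favorable submodel. -/
lemma improvement_eq {P : Measure 𝒵} (hP : P ∈ S.model) (hΨ : 0 < S.improvement P)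
    {β₀ : S.F → S.B} (hβ₀ : ∀ f β, S.fit P f (β₀ f) ≤ S.fit P f β)
    {f₀ : S.F} (hf₀ : ∀ f, S.fit P f₀ (β₀ f₀) ≤ S.fit P f (β₀ f)) :
    S.improvement P = S.fit P f₀ S.zeroB - S.fit P f₀ (β₀ f₀) := by
  have hbest : S.best P ∉ S.reduced P := fun h => by
    have h1 : S.G P (S.bestReduced P) ≤ S.G P (S.best P) := S.bestReduced_isMinOn P hP h
    rw [improvement] at hΨ
    linarith
  obtain ⟨f, hf, β, hβ, h⟩ := S.exhaust P hP (S.best P) ⟨S.best_mem P hP, hbest⟩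
  have h1 : S.fit P ⟨f, hf⟩ ⟨β, hβ⟩ = S.G P (S.best P) := by rw [h]; rfl
  have h2 := (hf₀ ⟨f, hf⟩).trans (hβ₀ ⟨f, hf⟩ ⟨β, hβ⟩)
  rw [fit_zero, improvement, le_antisymm (S.best_le_fit hP f₀ (β₀ f₀)) (h2.trans h1.le)]

/-- If the improvement in fit is pathwise differentiable, its derivatives are those of the
improvement along the least favorable submodel, since the former is at least the latter, with
equality at `P₀`. -/
lemma isEfficientInfluenceFunction_improvement {P₀ : Measure 𝒵}
    [IsProbabilityMeasure P₀] {f₀ : S.F} {β : S.B}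
    (hΨ : S.improvement P₀ = S.fit P₀ f₀ S.zeroB - S.fit P₀ f₀ β)
    {φ₀ φ₁ : 𝒵 → ℝ}
    (hφ₀ : IsEfficientInfluenceFunction S.model (fun P => S.fit P f₀ S.zeroB) P₀ φ₀)
    (hφ₁ : IsEfficientInfluenceFunction S.model (fun P => S.fit P f₀ β) P₀ φ₁)
    (hdiff : IsPathwiseDifferentiable S.model S.improvement P₀) :
    IsEfficientInfluenceFunction S.model S.improvement P₀ (fun z => φ₀ z - φ₁ z) := by
  obtain ⟨D, -, -, hD⟩ := hdiff
  obtain ⟨hφ₀2, hφ₀_mean, hφ₀d⟩ := hφ₀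
  obtain ⟨hφ₁2, hφ₁_mean, hφ₁d⟩ := hφ₁
  refine ⟨hφ₀2.sub hφ₁2, ?_, fun p s hp => ?_⟩
  · rw [integral_sub (hφ₀2.integrable one_le_two) (hφ₁2.integrable one_le_two), hφ₀_mean,
      hφ₁_mean, sub_zero]
  have hs : MemLp s 2 P₀ := hp.2.2.1
  have h_int : ∫ z, (φ₀ z - φ₁ z) * s z ∂P₀ = ∫ z, φ₀ z * s z ∂P₀ - ∫ z, φ₁ z * s z ∂P₀ := by
    simp only [sub_mul]
    exact integral_sub (hφ₀2.integrable_mul hs) (hφ₁2.integrable_mul hs)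
  have hder := (hD p s hp).sub ((hφ₀d p s hp).sub (hφ₁d p s hp))
  -- The direction and `β` stay fixed along the path, so Fermat's rule applies without any
  -- smoothness of the minimizers in `t`.
  have hmin : IsLocalMin ((fun t => S.improvement (p t)) -
      ((fun t => S.fit (p t) f₀ S.zeroB) - fun t => S.fit (p t) f₀ β)) 0 := by
    filter_upwards [hp.2.1] with t ht
    have h1 := S.best_le_fit ht f₀ β
    simp only [Pi.sub_apply, hp.1, hΨ, sub_self]
    rw [fit_zero, improvement]
    linarith
  have h0 := hmin.hasDerivAt_eq_zero hder
  rw [h_int, ← sub_eq_zero.1 h0]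
  exact hD p s hp

/-- The estimator of the improvement in fit has the expansion of the estimators of the fit along
the least favorable submodel. -/
lemma tendstoInMeasure_improvementEstimator {Ω : Type w} [MeasurableSpace Ω] {μ : Measure Ω}
    [IsProbabilityMeasure μ] {P₀ : Measure 𝒵} [IsProbabilityMeasure P₀]
    {Z : ℕ → Ω → 𝒵} (hZ_meas : ∀ i, Measurable (Z i)) (hZ_indep : iIndepFun Z μ)
    (hZ_law : ∀ i, μ.map (Z i) = P₀)
    {β₀ : S.F → S.B} (hβ₀ : ∀ f β, S.fit P₀ f (β₀ f) ≤ S.fit P₀ f β)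
    {f₀ : S.F} (hf₀ : ∀ f, S.fit P₀ f₀ (β₀ f₀) ≤ S.fit P₀ f (β₀ f))
    {Gn : ℕ → Ω → S.F → S.B → ℝ} {βn : ℕ → Ω → S.F → S.B}
    (hβn : SupLittleOPRootN μ (ι := S.F × S.B)
      (fun n ω i => Gn n ω i.1 (βn n ω i.1) - Gn n ω i.1 i.2))
    {φ : S.F → S.B → 𝒵 → ℝ} (hφ_mean : ∀ f β, ∫ z, φ f β z ∂P₀ = 0)
    (hφ : IsDonsker P₀ (fun i : S.F × S.B => φ i.1 i.2))
    (hGn_zero : ∀ n, ∀ᵐ ω ∂μ, ∀ f₁ f₂ : S.F, Gn n ω f₁ S.zeroB = Gn n ω f₂ S.zeroB)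
    (hGn : SupLittleOPRootN μ (ι := S.F × S.B) (fun n ω i =>
      |Gn n ω i.1 i.2 - S.fit P₀ i.1 i.2 - empMean (φ i.1 i.2) (fun j => Z j ω) n|))
    (hsep : ∀ δ > 0, ∃ η > 0, ∀ f β, S.fit P₀ f β - S.fit P₀ f₀ (β₀ f₀) ≤ η →
      Var[φ f β - φ f₀ (β₀ f₀); P₀] ≤ δ) :
    TendstoInMeasure μ
      (fun (n : ℕ) ω => √(n : ℝ) * (S.improvementEstimator Gn βn n ω
        - (S.fit P₀ f₀ S.zeroB - S.fit P₀ f₀ (β₀ f₀))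
        - empMean (fun z => φ f₀ S.zeroB z - φ f₀ (β₀ f₀) z) (fun i => Z i ω) n))
      atTop (fun _ => 0) := by
  rw [tendstoInMeasure_iff_dist]
  intro ε' hε'
  obtain ⟨ε, hε, hεε'⟩ : ∃ ε : ℝ, 0 < ε ∧ 3 * ε < ε' := ⟨ε' / 4, by positivity, by linarith⟩
  rw [← ENNReal.tendsto_toReal_zero_iff fun _ => measure_ne_top _ _]
  refine tendsto_order.2 ⟨fun c hc => Eventually.of_forall fun n =>
    hc.trans_le ENNReal.toReal_nonneg, fun κ hκ => ?_⟩
  have hκ3 : 0 < κ / 3 := by positivity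
  have hinf := hφ.eventually_infimum (fit := fun i : S.F × S.B => S.fit P₀ i.1 i.2)
    (t₀ := (f₀, β₀ f₀)) (fun i => (hf₀ i.1).trans (hβ₀ i.1 i.2))
    (fun δ hδ => (hsep δ hδ).imp fun η h => ⟨h.1, fun i => h.2 i.1 i.2⟩) hε hκ3
  filter_upwards [hinf, hβn.eventually_measureReal_lt hε hκ3,
    hGn.eventually_measureReal_lt hε hκ3, eventually_gt_atTop 0] with n h1 h2 h3 hn
  have ha : 0 < √(n : ℝ) := Real.sqrt_pos.2 (by exact_mod_cast hn)
  replace h1 := (measureReal_sample_le hZ_meas hZ_indep hZ_law _).trans_lt h1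
  -- Exceptional events: failure of the infimum bound, of near-minimization and of the uniform
  -- expansion, each of outer probability below `κ / 3`, and the null event `A₄` of disagreement at
  -- `β = 0`. Off their union the argument is deterministic.
  set A₁ := {ω | (fun i => Z i ω) ∈ {z | ∃ t : S.F × S.B, √(n : ℝ) * S.fit P₀ t.1 t.2 +
      empProcess P₀ (fun i : S.F × S.B => φ i.1 i.2) n z t <
    √(n : ℝ) * S.fit P₀ f₀ (β₀ f₀) +
      empProcess P₀ (fun i : S.F × S.B => φ i.1 i.2) n z (f₀, β₀ f₀) - ε}}
  set A₂ := {ω | ∃ i : S.F × S.B, ε < √(n : ℝ) * (Gn n ω i.1 (βn n ω i.1) - Gn n ω i.1 i.2)}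
  set A₃ := {ω | ∃ i : S.F × S.B, ε < √(n : ℝ) *
    |Gn n ω i.1 i.2 - S.fit P₀ i.1 i.2 - empMean (φ i.1 i.2) (fun j => Z j ω) n|}
  have hN : μ.real {ω | ¬ ∀ f₁ f₂ : S.F, Gn n ω f₁ S.zeroB = Gn n ω f₂ S.zeroB} = 0 := by
    rw [measureReal_def, ae_iff.1 (hGn_zero n), ENNReal.toReal_zero]
  set A₄ := {ω | ¬ ∀ f₁ f₂ : S.F, Gn n ω f₁ S.zeroB = Gn n ω f₂ S.zeroB}
  have hunion : μ.real (A₁ ∪ A₂ ∪ A₃ ∪ A₄) < κ := by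
    have h4 := measureReal_union_le (μ := μ) (A₁ ∪ A₂ ∪ A₃) A₄
    have h5 := measureReal_union_le (μ := μ) (A₁ ∪ A₂) A₃
    have h6 := measureReal_union_le (μ := μ) A₁ A₂
    linarith
  refine lt_of_le_of_lt (measureReal_mono fun ω hω => ?_) hunion
  by_contra hnot
  simp only [Set.mem_union, not_or] at hnot
  obtain ⟨⟨⟨hω₁, hω₂⟩, hω₃⟩, hω₄⟩ := hnot
  simp only [A₁, A₂, A₃, A₄, Set.mem_ofPred_eq, not_exists, not_lt, not_not] at hω₁ hω₂ hω₃ hω₄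
  have hemp (i : S.F × S.B) : empProcess P₀ (fun i : S.F × S.B => φ i.1 i.2) n
      (fun j => Z j ω) i = √(n : ℝ) * empMean (φ i.1 i.2) (fun j => Z j ω) n := by
    rw [empProcess, hφ_mean, sub_zero]
  have key := abs_sub_iSup_improvement_le (G := Gn n ω) (fit := S.fit P₀)
    (E := fun f β => √(n : ℝ) * empMean (φ f β) (fun j => Z j ω) n) (b := βn n ω) (b₀ := β₀)
    (f₀ := f₀) (o := S.zeroB) (ε := ε) ha hω₄ (fun f β => hω₂ (f, β))
    (fun f β => by
      have h4 := hω₃ (f, β)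
      rwa [← abs_of_pos ha, ← abs_mul, mul_sub] at h4)
    (fun f β => by
      have h4 := hω₁ (f, β)
      rwa [hemp, hemp] at h4)
  have hmean : empMean (fun z => φ f₀ S.zeroB z - φ f₀ (β₀ f₀) z) (fun i => Z i ω) n =
      empMean (φ f₀ S.zeroB) (fun i => Z i ω) n - empMean (φ f₀ (β₀ f₀)) (fun i => Z i ω) n := by
    simp only [empMean, Finset.sum_sub_distrib, mul_sub]
  simp only [Set.mem_ofPred_eq, Real.dist_eq, sub_zero] at hω
  rw [hmean, mul_sub, mul_sub (√(n : ℝ)) (empMean _ _ _)] at hω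
  exact absurd (hω.trans key) (not_le.2 hεε')

end Framework

end ImprovementInFit

end

/-! ### Asymptotic linearity and efficiency. -/

open ImprovementInFit in
theorem theorem3 {Ω : Type*} [MeasurableSpace Ω] (μ : Measure Ω) [IsProbabilityMeasure μ]
    {𝒵 : Type*} [MeasurableSpace 𝒵] {𝒪 : Type*} {𝒦 : Set ℝ} (S : Framework 𝒵 𝒪 𝒦)
    -- the true distribution, at which the model is nonparametric
    (P₀ : Measure 𝒵) [IsProbabilityMeasure P₀] (hP₀ : P₀ ∈ S.model)
    (hnonpar : IsNonparametricAt S.model P₀)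
    -- the i.i.d. observations
    (Z : ℕ → Ω → 𝒵) (hZ_meas : ∀ i, Measurable (Z i)) (hZ_indep : iIndepFun Z μ)
    (hZ_law : ∀ i, μ.map (Z i) = P₀)
    -- `β₀ f` minimizes the fit along the submodel of `f`, and `f₀` is a least favorable direction
    (β₀ : S.F → S.B) (hβ₀ : ∀ f β, S.fit P₀ f (β₀ f) ≤ S.fit P₀ f β)
    (f₀ : S.F) (hf₀ : ∀ f, S.fit P₀ f₀ (β₀ f₀) ≤ S.fit P₀ f (β₀ f))
    -- the estimator of the goodness of fit, and its near-minimizers along the submodels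
    (Gn : ℕ → Ω → S.F → S.B → ℝ) (βn : ℕ → Ω → S.F → S.B)
    (hβn : SupLittleOPRootN μ (ι := S.F × S.B)
      (fun n ω i => Gn n ω i.1 (βn n ω i.1) - Gn n ω i.1 i.2))
    -- the improvement in fit is positive
    (hΨ : 0 < S.improvement P₀)
    -- the goodness of fit is pathwise differentiable, with efficient influence functions `φ f β`
    (φ : S.F → S.B → 𝒵 → ℝ)
    (hA1 : ∀ f β, IsEfficientInfluenceFunction S.model (fun P => S.fit P f β) P₀ (φ f β))
    -- the influence functions form a Donsker class
    (hA5 : IsDonsker P₀ (fun i : S.F × S.B => φ i.1 i.2))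
    -- the estimators agree at `β = 0`
    (hB1 : ∀ n, ∀ᵐ ω ∂μ, ∀ f₁ f₂ : S.F, Gn n ω f₁ S.zeroB = Gn n ω f₂ S.zeroB)
    -- the estimators are asymptotically linear, uniformly over `ℱ × ℬ`
    (hB2 : SupLittleOPRootN μ (ι := S.F × S.B) (fun n ω i =>
      |Gn n ω i.1 i.2 - S.fit P₀ i.1 i.2 - empMean (φ i.1 i.2) (fun j => Z j ω) n|))
    -- the margin condition
    (d : ℕ → ℝ) (hd_pos : ∀ᶠ n in atTop, 0 < d n)
    (hd : ∃ δ : ℝ, 0 < δ ∧ d =o[atTop] fun n : ℕ => (n : ℝ) ^ (1 / 2 - δ : ℝ))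
    (hmargin : Tendsto (fun n => ⨆ (f : S.F) (β : S.B)
        (_ : S.fit P₀ f β - S.fit P₀ f₀ (β₀ f₀) ≤ d n),
        eLpNorm (fun z => φ f β z - φ f₀ (β₀ f₀) z) 2 P₀) atTop (𝓝 0)) :
    IsAsymptoticallyLinear μ Z P₀ (S.improvementEstimator Gn βn) (S.improvement P₀)
        (fun z => φ f₀ S.zeroB z - φ f₀ (β₀ f₀) z) ∧
      (IsPathwiseDifferentiable S.model S.improvement P₀ →
        IsEfficientInfluenceFunction S.model S.improvement P₀
            (fun z => φ f₀ S.zeroB z - φ f₀ (β₀ f₀) z) ∧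
          IsAsymptoticallyEfficient μ Z S.model S.improvement P₀
            (S.improvementEstimator Gn βn)) := by
  have hΨ_eq := S.improvement_eq hP₀ hΨ hβ₀ hf₀
  have h2 := hA5.2.1
  have hD := S.isEfficientInfluenceFunction_improvement hΨ_eq (hA1 f₀ S.zeroB) (hA1 f₀ (β₀ f₀))
  have hsep : ∀ δ > 0, ∃ η > 0, ∀ f β, S.fit P₀ f β - S.fit P₀ f₀ (β₀ f₀) ≤ η →
      Var[φ f β - φ f₀ (β₀ f₀); P₀] ≤ δ := by
    intro δ hδ
    -- The margin condition at one index, unrelated to the sample size, gives a fixed separation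
    -- level `η = d n > 0`.
    obtain ⟨n, hn, hdn⟩ := ((hmargin.eventually_lt_const
      (ENNReal.ofReal_pos.2 (Real.sqrt_pos.2 hδ))).and hd_pos).exists
    refine ⟨d n, hdn, fun f β hfβ => ?_⟩
    have h3 : eLpNorm (fun z => φ f β z - φ f₀ (β₀ f₀) z) 2 P₀ ≤ ENNReal.ofReal (√δ) :=
      le_trans (le_iSup₂_of_le f β (by rw [iSup_pos hfβ])) hn.le
    have h4 := variance_le_of_eLpNorm_le ((h2 (f, β)).sub (h2 (f₀, β₀ f₀)))
      (Real.sqrt_nonneg δ) h3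
    rwa [Real.sq_sqrt hδ.le] at h4
  have hlin : IsAsymptoticallyLinear μ Z P₀ (S.improvementEstimator Gn βn) (S.improvement P₀)
      (fun z => φ f₀ S.zeroB z - φ f₀ (β₀ f₀) z) := by
    refine ⟨(h2 (f₀, S.zeroB)).sub (h2 (f₀, β₀ f₀)), ?_, ?_⟩
    · rw [integral_sub ((h2 (f₀, S.zeroB)).integrable one_le_two)
        ((h2 (f₀, β₀ f₀)).integrable one_le_two), (hA1 f₀ S.zeroB).2.1, (hA1 f₀ (β₀ f₀)).2.1,
        sub_zero]
    · rw [hΨ_eq]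
      exact S.tendstoInMeasure_improvementEstimator hZ_meas hZ_indep hZ_law hβ₀ hf₀ hβn
        (fun f β => (hA1 f β).2.1) hA5 hB1 hB2 hsep
  exact ⟨hlin, fun hdiff => ⟨hD hdiff, _, hD hdiff, hlin⟩⟩
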